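/- Let $(\mathcal{C},\mathbb{E},\mathfrak{s})$ be an extriangulated category (in the sense of Nakaoka and Palu) whose underlying additive category $\mathcal{C}$ is Krull–Schmidt, i.e. every object is a finite direct sum of objects with local endomorphism rings. Let $\mathfrak{s}\text{-tri}(\mathcal{C})$ be the category whose objects are the $\mathfrak{s}$-triangles $X_\bullet=(X_1\xrightarrow{f_1}X_2\xrightarrow{f_2}X_3\overset{\delta}{\dashrightarrow})$, $\delta\in\mathbb{E}(X_3,X_1)$, and whose morphisms from $X_\bullet$ to $Y_\bullet=(Y_1\xrightarrow{g_1}Y_2\xrightarrow{g_2}Y_3\overset{\delta'}{\dashrightarrow})$ are the triples $\varphi_\bullet=(\varphi_1,\varphi_2,\varphi_3)$, $\varphi_i:X_i\to Y_i$, with $\varphi_2f_1=g_1\varphi_1$, $\varphi_3f_2=g_2\varphi_2$ and $\varphi_{1*}\delta=\varphi_3^*\delta'$. Let $\mathcal{R}_2$ be the ideal of $\mathfrak{s}\text{-tri}(\mathcal{C})$ consisting of the morphisms $\varphi_\bullet:X_\bullet\to Y_\bullet$ such that $\varphi_3$ factors through $g_2$, and let $\mathfrak{s}\text{-tri}(\mathcal{C})/\mathcal{R}_2$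 be the quotient category. An $\mathfrak{s}$-triangle $X_\bullet$ is split if $\delta=0$, and it is an Auslander–Reiten $\mathfrak{s}$-triangle if it is non-split, every morphism $g:X_1\to Y$ that is not a section factors through $f_1$, and every morphism $h:Z\to X_3$ that is not a retraction factors through $f_2$. Let $X_\bullet=(X_1\xrightarrow{f_1}X_2\xrightarrow{f_2}X_3\overset{\delta}{\dashrightarrow})$ be a non-split $\mathfrak{s}$-triangle such that $X_1$ is indecomposable, and assume that - $X_3$ is indecomposable, or - $X_2$ is indecomposable and $f_1\neq 0$. Then $X_\bullet$ is a simple object of $\mathfrak{s}\text{-tri}(\mathcal{C})/\mathcal{R}_2$ if and only if $X_\bullet$ is an Auslander–Reiten $\mathfrak{s}$-triangle in $\mathcal{C}$. -/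

import Mathlib

open CategoryTheory CategoryTheory.Limits Opposite

universe w v u

namespace Extri

/-! ### Extensions of a bifunctor `E : Cᵒᵖ × C → Ab` -/

section Extensions

variable {C : Type u} [Category.{v} C] (E : Cᵒᵖ ⥤ C ⥤ AddCommGrpCat.{w})

/-- The group `E(Z, A)` of extensions of `Z` by `A`. -/
abbrev Ext (Z A : C) : Type w := (E.obj (op Z)).obj A

variable {E}

/-- `a_* δ = E(Z, a)(δ)`. -/
def push {Z A A' : C} (a : A ⟶ A') : Ext E Z A →+ Ext E Z A' :=
  ((E.obj (op Z)).map a).hom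

/-- `c^* δ = E(c, A)(δ)`. -/
def pull {Z Z' A : C} (c : Z' ⟶ Z) : Ext E Z A →+ Ext E Z' A :=
  ((E.map c.op).app A).hom

theorem push_id {Z A : C} (δ : Ext E Z A) : push (𝟙 A) δ = δ := by
  simp [push]

theorem pull_id {Z A : C} (δ : Ext E Z A) : pull (𝟙 Z) δ = δ := by
  simp [pull]

theorem push_comp {Z A A' A'' : C} (a : A ⟶ A') (a' : A' ⟶ A'') (δ : Ext E Z A) :
    push (a ≫ a') δ = push a' (push a δ) := by
  simp [push]

theorem pull_comp {Z Z' Z'' A : C} (c' : Z'' ⟶ Z') (c : Z' ⟶ Z) (δ : Ext E Z A) :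
    pull (c' ≫ c) δ = pull c' (pull c δ) := by
  simp [pull]

theorem push_pull {Z Z' A A' : C} (a : A ⟶ A') (c : Z' ⟶ Z) (δ : Ext E Z A) :
    push a (pull c δ) = pull c (push a δ) := by
  have h := (E.map c.op).naturality a
  exact (ConcreteCategory.congr_hom h δ).symm

end Extensions

/-! ### Sequences and their equivalence classes -/

section Sequences

variable {C : Type u} [Category.{v} C]

/-- A sequence `A ⟶ B ⟶ Z` with fixed end terms. -/
structure Seq (A Z : C) where
  B : C
  x : A ⟶ B
  y : B ⟶ Z

/-- Two sequences with the same end terms are equivalent if there is an isomorphism of their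
middle terms which is compatible with the identities of the end terms. -/
instance seqSetoid (A Z : C) : Setoid (Seq A Z) where
  r s t := ∃ b : s.B ≅ t.B, s.x ≫ b.hom = t.x ∧ b.hom ≫ t.y = s.y
  iseqv :=
    { refl := fun s => ⟨Iso.refl _, by simp, by simp⟩
      symm := by
        rintro s t ⟨b, h₁, h₂⟩
        exact ⟨b.symm, by simp [← h₁], by simp [← h₂]⟩
      trans := by
        rintro s t r ⟨b, h₁, h₂⟩ ⟨b', h₁', h₂'⟩
        exact ⟨b ≪≫ b', by simp [reassoc_of% h₁, h₁'], by simp [h₂, h₂']⟩ }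

/-- Equivalence classes `[A ⟶ B ⟶ Z]`. -/
abbrev SeqClass (A Z : C) : Type max u v := Quotient (seqSetoid A Z)

/-- The class `[A ⟶ B ⟶ Z]` of a sequence. -/
def seqClass {A B Z : C} (x : A ⟶ B) (y : B ⟶ Z) : SeqClass A Z :=
  Quotient.mk (seqSetoid A Z) ⟨B, x, y⟩

end Sequences

/-! ### Extriangulated categories -/

section Extriangulated

instance hasBinaryBiproducts (C : Type u) [Category.{v} C] [Preadditive C]
    [HasFiniteBiproducts C] : HasBinaryBiproducts C :=
  hasBinaryBiproducts_of_finite_biproducts C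

/-- An extriangulated structure `(E, 𝔰)` on an additive category `C`. -/
structure ExtriangulatedStructure (C : Type u) [Category.{v} C] [Preadditive C]
    [HasFiniteBiproducts C] where
  /-- (ET1): the additive bifunctor `E`. -/
  E : Cᵒᵖ ⥤ C ⥤ AddCommGrpCat.{w}
  additive_left : E.Additive
  additive_right : ∀ Z : Cᵒᵖ, (E.obj Z).Additive
  /-- (ET2): `𝔰` assigns an equivalence class of sequences to each extension. -/
  𝔰 : ∀ {A Z : C}, Ext E Z A → SeqClass A Z
  /-- (ET2): each morphism of extensions is realized by a morphism of sequences. -/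
  realization : ∀ {A B Z A' B' Z' : C} {x : A ⟶ B} {y : B ⟶ Z} {x' : A' ⟶ B'} {y' : B' ⟶ Z'}
    {δ : Ext E Z A} {δ' : Ext E Z' A'}, 𝔰 δ = seqClass x y → 𝔰 δ' = seqClass x' y' →
    ∀ (a : A ⟶ A') (c : Z ⟶ Z'), push a δ = pull c δ' →
      ∃ b : B ⟶ B', x ≫ b = a ≫ x' ∧ y ≫ c = b ≫ y'
  /-- (ET2): the zero extension is realized by the split sequence. -/
  realization_zero : ∀ A Z : C,
    𝔰 (0 : Ext E Z A) = seqClass (biprod.inl : A ⟶ A ⊞ Z) (biprod.snd : A ⊞ Z ⟶ Z)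
  /-- (ET2): `𝔰 (δ ⊕ δ') = 𝔰 δ ⊕ 𝔰 δ'`. -/
  realization_sum : ∀ {A B Z A' B' Z' : C} {x : A ⟶ B} {y : B ⟶ Z} {x' : A' ⟶ B'} {y' : B' ⟶ Z'}
    {δ : Ext E Z A} {δ' : Ext E Z' A'}, 𝔰 δ = seqClass x y → 𝔰 δ' = seqClass x' y' →
    𝔰 (A := A ⊞ A') (Z := Z ⊞ Z')
        (pull biprod.fst (push biprod.inl δ) + pull biprod.snd (push biprod.inr δ')) =
      seqClass (biprod.map x x') (biprod.map y y')
  /-- (ET3) -/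
  et3 : ∀ {A B Z A' B' Z' : C} {x : A ⟶ B} {y : B ⟶ Z} {x' : A' ⟶ B'} {y' : B' ⟶ Z'}
    {δ : Ext E Z A} {δ' : Ext E Z' A'}, 𝔰 δ = seqClass x y → 𝔰 δ' = seqClass x' y' →
    ∀ (a : A ⟶ A') (b : B ⟶ B'), x ≫ b = a ≫ x' →
      ∃ c : Z ⟶ Z', y ≫ c = b ≫ y' ∧ push a δ = pull c δ'
  /-- (ET3)ᵒᵖ -/
  et3_op : ∀ {A B Z A' B' Z' : C} {x : A ⟶ B} {y : B ⟶ Z} {x' : A' ⟶ B'} {y' : B' ⟶ Z'}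
    {δ : Ext E Z A} {δ' : Ext E Z' A'}, 𝔰 δ = seqClass x y → 𝔰 δ' = seqClass x' y' →
    ∀ (b : B ⟶ B') (c : Z ⟶ Z'), y ≫ c = b ≫ y' →
      ∃ a : A ⟶ A', x ≫ b = a ≫ x' ∧ push a δ = pull c δ'
  /-- (ET4) -/
  et4 : ∀ {A B D Y F : C} {f : A ⟶ B} {f' : B ⟶ D} {g : B ⟶ Y} {g' : Y ⟶ F}
    {δ : Ext E D A} {δ' : Ext E F B}, 𝔰 δ = seqClass f f' → 𝔰 δ' = seqClass g g' →
    ∃ (G : C) (h : A ⟶ Y) (h' : Y ⟶ G) (d : D ⟶ G) (e : G ⟶ F) (δ'' : Ext E G A),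
      f ≫ g = h ∧ f' ≫ d = g ≫ h' ∧ h' ≫ e = g' ∧
      𝔰 δ'' = seqClass h h' ∧ 𝔰 (push f' δ') = seqClass d e ∧
      δ = pull d δ'' ∧ push f δ'' = pull e δ'
  /-- (ET4)ᵒᵖ -/
  et4_op : ∀ {A B D Y F : C} {f' : D ⟶ A} {f : A ⟶ B} {g' : F ⟶ B} {g : B ⟶ Y}
    {δ : Ext E B D} {δ' : Ext E Y F}, 𝔰 δ = seqClass f' f → 𝔰 δ' = seqClass g' g →
    ∃ (G : C) (d : D ⟶ G) (e : G ⟶ F) (h' : G ⟶ A) (h : A ⟶ Y) (δ'' : Ext E Y G),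
      d ≫ h' = f' ∧ h' ≫ f = e ≫ g' ∧ f ≫ g = h ∧
      𝔰 (pull g' δ) = seqClass d e ∧ 𝔰 δ'' = seqClass h' h ∧
      δ' = push e δ'' ∧ push d δ = pull g δ''

/-- An additive category is Krull–Schmidt if each object is a finite direct sum of objects with
local endomorphism rings. -/
def IsKrullSchmidt (C : Type u) [Category.{v} C] [Preadditive C] [HasFiniteBiproducts C] : Prop :=
  ∀ X : C, ∃ (n : ℕ) (F : Fin n → C),
    (∀ i, IsLocalRing (End (F i))) ∧ Nonempty (X ≅ ⨁ F)

end Extriangulated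

/-! ### The category of `𝔰`-triangles -/

section Triangles

variable {C : Type u} [Category.{v} C] [Preadditive C] [HasFiniteBiproducts C]

instance (S : ExtriangulatedStructure.{w} C) : S.E.Additive := S.additive_left

instance (S : ExtriangulatedStructure.{w} C) (Z : Cᵒᵖ) : (S.E.obj Z).Additive :=
  S.additive_right Z

theorem push_add {S : ExtriangulatedStructure.{w} C} {Z A A' : C} (a b : A ⟶ A')
    (δ : Ext S.E Z A) : push (a + b) δ = push a δ + push b δ := by
  simp [push, Functor.map_add]

theorem pull_add {S : ExtriangulatedStructure.{w} C} {Z Z' A : C} (a b : Z' ⟶ Z)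
    (δ : Ext S.E Z A) : pull (a + b) δ = pull a δ + pull b δ := by
  simp [pull, Functor.map_add]

/-- `𝔰`-triangles `X₁ ⟶ X₂ ⟶ X₃ ⇢ δ`. -/
structure STriangle (S : ExtriangulatedStructure.{w} C) where
  {X₁ X₂ X₃ : C}
  f₁ : X₁ ⟶ X₂
  f₂ : X₂ ⟶ X₃
  δ : Ext S.E X₃ X₁
  realizes : S.𝔰 δ = seqClass f₁ f₂

variable {S : ExtriangulatedStructure.{w} C}

namespace STriangle

/-- Morphisms of `𝔰`-triangles. -/
@[ext]
structure Hom (X Y : STriangle S) where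
  φ₁ : X.X₁ ⟶ Y.X₁
  φ₂ : X.X₂ ⟶ Y.X₂
  φ₃ : X.X₃ ⟶ Y.X₃
  comm₁ : X.f₁ ≫ φ₂ = φ₁ ≫ Y.f₁
  comm₂ : X.f₂ ≫ φ₃ = φ₂ ≫ Y.f₂
  comm₃ : push φ₁ X.δ = pull φ₃ Y.δ

/-- The category `𝔰-tri(C)`, with componentwise composition. -/
instance : Category (STriangle S) where
  Hom X Y := Hom X Y
  id X := ⟨𝟙 _, 𝟙 _, 𝟙 _, by simp, by simp, by rw [push_id, pull_id]⟩
  comp φ ψ := ⟨φ.φ₁ ≫ ψ.φ₁, φ.φ₂ ≫ ψ.φ₂, φ.φ₃ ≫ ψ.φ₃,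
    by rw [← Category.assoc, φ.comm₁, Category.assoc, ψ.comm₁, Category.assoc],
    by rw [← Category.assoc, φ.comm₂, Category.assoc, ψ.comm₂, Category.assoc],
    by rw [push_comp, φ.comm₃, push_pull, ψ.comm₃, ← pull_comp]⟩
  id_comp φ := by apply Hom.ext <;> exact Category.id_comp _
  comp_id φ := by apply Hom.ext <;> exact Category.comp_id _
  assoc φ ψ χ := by apply Hom.ext <;> exact Category.assoc _ _ _

@[ext]
theorem hom_ext {X Y : STriangle S} {φ ψ : X ⟶ Y} (h₁ : φ.φ₁ = ψ.φ₁) (h₂ : φ.φ₂ = ψ.φ₂)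
    (h₃ : φ.φ₃ = ψ.φ₃) : φ = ψ := Hom.ext h₁ h₂ h₃

@[simp] theorem comp_φ₁ {X Y Z : STriangle S} (φ : X ⟶ Y) (ψ : Y ⟶ Z) :
    (φ ≫ ψ).φ₁ = φ.φ₁ ≫ ψ.φ₁ := rfl
@[simp] theorem comp_φ₂ {X Y Z : STriangle S} (φ : X ⟶ Y) (ψ : Y ⟶ Z) :
    (φ ≫ ψ).φ₂ = φ.φ₂ ≫ ψ.φ₂ := rfl
@[simp] theorem comp_φ₃ {X Y Z : STriangle S} (φ : X ⟶ Y) (ψ : Y ⟶ Z) :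
    (φ ≫ ψ).φ₃ = φ.φ₃ ≫ ψ.φ₃ := rfl

theorem push_zero' {Z A A' : C} (δ : Ext S.E Z A) : push (0 : A ⟶ A') δ = 0 := by
  have h := push_add (0 : A ⟶ A') 0 δ
  rw [add_zero] at h
  exact left_eq_add.mp h

theorem pull_zero' {Z Z' A : C} (δ : Ext S.E Z A) : pull (0 : Z' ⟶ Z) δ = 0 := by
  have h := pull_add (0 : Z' ⟶ Z) 0 δ
  rw [add_zero] at h
  exact left_eq_add.mp h

theorem push_neg' {Z A A' : C} (a : A ⟶ A') (δ : Ext S.E Z A) : push (-a) δ = -push a δ := by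
  rw [eq_neg_iff_add_eq_zero, ← push_add, neg_add_cancel, push_zero']

theorem pull_neg' {Z Z' A : C} (c : Z' ⟶ Z) (δ : Ext S.E Z A) : pull (-c) δ = -pull c δ := by
  rw [eq_neg_iff_add_eq_zero, ← pull_add, neg_add_cancel, pull_zero']

/-- `𝔰-tri(C)` is preadditive, with componentwise addition. -/
instance : Preadditive (STriangle S) where
  homGroup X Y :=
    let iZ : Zero (X ⟶ Y) :=
      ⟨⟨0, 0, 0, by simp, by simp, by rw [push_zero', pull_zero']⟩⟩
    let iA : Add (X ⟶ Y) :=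
      ⟨fun φ ψ => ⟨φ.φ₁ + ψ.φ₁, φ.φ₂ + ψ.φ₂, φ.φ₃ + ψ.φ₃,
        by rw [Preadditive.comp_add, Preadditive.add_comp, φ.comm₁, ψ.comm₁],
        by rw [Preadditive.comp_add, Preadditive.add_comp, φ.comm₂, ψ.comm₂],
        by rw [push_add, pull_add, φ.comm₃, ψ.comm₃]⟩⟩
    let iN : Neg (X ⟶ Y) :=
      ⟨fun φ => ⟨-φ.φ₁, -φ.φ₂, -φ.φ₃,
        by rw [Preadditive.comp_neg, Preadditive.neg_comp, φ.comm₁],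
        by rw [Preadditive.comp_neg, Preadditive.neg_comp, φ.comm₂],
        by rw [push_neg', pull_neg', φ.comm₃]⟩⟩
    { add_assoc := fun φ ψ χ => by apply Hom.ext <;> exact add_assoc _ _ _
      zero_add := fun φ => by apply Hom.ext <;> exact zero_add _
      add_zero := fun φ => by apply Hom.ext <;> exact add_zero _
      add_comm := fun φ ψ => by apply Hom.ext <;> exact add_comm _ _
      neg_add_cancel := fun φ => by apply Hom.ext <;> exact neg_add_cancel _
      nsmul := nsmulRec
      zsmul := zsmulRec }
  add_comp X Y Z φ φ' ψ := by apply Hom.ext <;> exact Preadditive.add_comp _ _ _ _ _ _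
  comp_add X Y Z φ ψ ψ' := by apply Hom.ext <;> exact Preadditive.comp_add _ _ _ _ _ _

@[simp] theorem add_φ₃ {X Y : STriangle S} (φ ψ : X ⟶ Y) : (φ + ψ).φ₃ = φ.φ₃ + ψ.φ₃ := rfl
@[simp] theorem neg_φ₃ {X Y : STriangle S} (φ : X ⟶ Y) : (-φ).φ₃ = -φ.φ₃ := rfl
@[simp] theorem sub_φ₃ {X Y : STriangle S} (φ ψ : X ⟶ Y) : (φ - ψ).φ₃ = φ.φ₃ - ψ.φ₃ := by
  rw [sub_eq_add_neg, sub_eq_add_neg, add_φ₃, neg_φ₃]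

/-- `φ ∈ R₂(X, Y)`: the third component of `φ` factors through `Y.f₂`. -/
def IsR₂ {X Y : STriangle S} (φ : X ⟶ Y) : Prop :=
  ∃ p : X.X₃ ⟶ Y.X₂, p ≫ Y.f₂ = φ.φ₃

variable (S) in
/-- Congruence modulo the ideal `R₂`. -/
def relR₂ : HomRel (STriangle S) := fun _ _ φ ψ => IsR₂ (φ - ψ)

instance : Congruence (relR₂ S) where
  comp_left φ ψ ψ' := by
    rintro ⟨p, hp⟩
    exact ⟨φ.φ₃ ≫ p, by simp [hp]⟩
  comp_right ψ := by
    rintro ⟨p, hp⟩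
    refine ⟨p ≫ ψ.φ₂, ?_⟩
    rw [Category.assoc, ← ψ.comm₂, ← Category.assoc, hp]
    simp
  equivalence :=
    { refl := fun φ => ⟨0, by rw [sub_self, zero_comp]; rfl⟩
      symm := by
        rintro φ ψ ⟨p, hp⟩
        exact ⟨-p, by simp [hp]⟩
      trans := by
        rintro φ ψ χ ⟨p, hp⟩ ⟨q, hq⟩
        exact ⟨p + q, by simp [hp, hq]⟩ }

end STriangle

open STriangle

variable (S) in
/-- The quotient category `𝔰-tri(C)/R₂`. -/
abbrev STriModR₂ := CategoryTheory.Quotient (relR₂ S)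

/-- The additive structure on morphisms of `𝔰-tri(C)/R₂` induced by that of `𝔰-tri(C)`. -/
instance : Preadditive (STriModR₂ S) :=
  CategoryTheory.Quotient.preadditive (relR₂ S) (by
    rintro X Y φ₁ φ₂ ψ₁ ψ₂ ⟨p, hp⟩ ⟨q, hq⟩
    refine ⟨p + q, ?_⟩
    rw [Preadditive.add_comp, hp, hq]
    simp only [sub_φ₃, add_φ₃]
    abel)

/-- An `𝔰`-triangle, as an object of `𝔰-tri(C)/R₂`. -/
abbrev STriangle.toQuotient (X : STriangle S) : STriModR₂ S :=
  (CategoryTheory.Quotient.functor (relR₂ S)).obj X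

/-- An `𝔰`-triangle is split if its extension is zero. -/
def STriangle.IsSplit (X : STriangle S) : Prop := X.δ = 0

/-- Auslander–Reiten `𝔰`-triangles. A section is a split monomorphism, a retraction is a split
epimorphism. -/
structure STriangle.IsAuslanderReiten (X : STriangle S) : Prop where
  nonsplit : ¬ X.IsSplit
  factors_left : ∀ {Y : C} (g : X.X₁ ⟶ Y), ¬ IsSplitMono g → ∃ k : X.X₂ ⟶ Y, X.f₁ ≫ k = g
  factors_right : ∀ {Z : C} (h : Z ⟶ X.X₃), ¬ IsSplitEpi h → ∃ k : Z ⟶ X.X₂, k ≫ X.f₂ = h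

end Triangles

end Extri

/-! Modulo `R₂`, a morphism `φ : X ⟶ Y` is determined by the extension `pull φ.φ₃ Y.δ`
(`proj_map_eq_iff`), and base changes become monomorphisms (`mono_proj_map_iff`). If `X` is
Auslander–Reiten, a nonzero mono into it has a retraction as third component; its section lifts to a
morphism of triangles, so the mono splits. If `X` is simple, every base change of `X` is zero or
invertible in the quotient. Applied to `c` itself this gives right almost splitness; applied to the
deflation of a cobase change along `g` it gives the left one. Local endomorphism rings turn the
resulting relations `1 = a + b` into sections and retractions. -/

section Preliminaries

open CategoryTheory CategoryTheory.Limits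

variable {C : Type u} [Category.{v} C] [Preadditive C]

/-- Jacobson's trick: if `w` inverts `1 - fp`, then `1 + pwf` inverts `1 - pf`. -/
theorem isIso_id_sub_comp_of_isIso {A B : C} (f : A ⟶ B) (p : B ⟶ A)
    (h : IsIso (𝟙 A - f ≫ p)) : IsIso (𝟙 B - p ≫ f) := by
  let w := inv (𝟙 A - f ≫ p)
  have h₁ : w - w ≫ f ≫ p = 𝟙 A := by
    have := IsIso.inv_hom_id (𝟙 A - f ≫ p)
    rwa [Preadditive.comp_sub, Category.comp_id] at this
  have h₂ : w - f ≫ p ≫ w = 𝟙 A := by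
    have := IsIso.hom_inv_id (𝟙 A - f ≫ p)
    rwa [Preadditive.sub_comp, Category.id_comp, Category.assoc] at this
  refine ⟨𝟙 B + p ≫ w ≫ f, ?_, ?_⟩
  · have h := congrArg (fun t => p ≫ t ≫ f) h₂
    simp only [Preadditive.comp_sub, Preadditive.sub_comp, Category.assoc, Category.id_comp] at h
    simp only [Preadditive.comp_add, Preadditive.sub_comp, Category.assoc, Category.id_comp,
      Category.comp_id]
    rw [← sub_eq_zero] at h ⊢
    rw [← h]
    abel
  · have h := congrArg (fun t => p ≫ t ≫ f) h₁
    simp only [Preadditive.comp_sub, Preadditive.sub_comp, Category.assoc, Category.id_comp] at h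
    simp only [Preadditive.comp_sub, Preadditive.add_comp, Category.assoc, Category.id_comp,
      Category.comp_id]
    rw [← sub_eq_zero] at h ⊢
    rw [← h]
    abel

variable [HasFiniteBiproducts C]

/-- A biproduct over `Fin (n + 1)` is the biproduct of its first summand and of the others. -/
noncomputable def biproductFinSuccIso {n : ℕ} (F : Fin (n + 1) → C) :
    (⨁ F) ≅ F 0 ⊞ ⨁ (fun i : Fin n => F i.succ) where
  hom := biprod.lift (biproduct.π F 0) (biproduct.lift fun i => biproduct.π F i.succ)
  inv := biprod.desc (biproduct.ι F 0) (biproduct.desc fun i => biproduct.ι F i.succ)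
  hom_inv_id := by
    simp [biprod.lift_desc, biproduct.lift_desc, ← Fin.sum_univ_succ
      (fun i => biproduct.π F i ≫ biproduct.ι F i), biproduct.total]
  inv_hom_id := by
    ext i j
    · simp
    · simp [biproduct.ι_π_ne F (Fin.succ_ne_zero _).symm]
    · simp [biproduct.ι_π_ne F (Fin.succ_ne_zero _)]
    · by_cases hij : i = j
      · subst hij
        simp
      · simp [biproduct.ι_π_ne _ hij, biproduct.ι_π_ne F (fun h => hij (Fin.succ_injective _ h))]

/-- Peel off one local summand; indecomposability kills the rest, so `End X` is local. -/
theorem isIso_or_isIso_of_add_eq_id (hC : Extri.IsKrullSchmidt C) {X : C} (hX : Indecomposable X)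
    (a b : X ⟶ X) (hab : a + b = 𝟙 X) : IsIso a ∨ IsIso b := by
  obtain ⟨n, F, hF, ⟨e⟩⟩ := hC X
  cases n with
  | zero =>
    refine absurd ((IsZero.iff_id_eq_zero _).2 ?_) hX.1
    rw [← cancel_mono e.hom]
    exact biproduct.hom_ext _ _ fun i => i.elim0
  | succ n =>
    have := hF 0
    rcases hX.2 _ _ (e ≪≫ biproductFinSuccIso F) with h | h
    · exact absurd ((IsZero.iff_id_eq_zero _).1 h) (one_ne_zero (α := End (F 0)))
    · let i : X ≅ F 0 := e ≪≫ biproductFinSuccIso F ≪≫ (isoBiprodZero h).symm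
      have key : ∀ c : X ⟶ X, IsUnit (End.of (i.inv ≫ c ≫ i.hom)) → IsIso c := by
        intro c hc
        have hc' : IsIso (i.inv ≫ c ≫ i.hom) := (isUnit_iff_isIso _).1 hc
        have : c = i.hom ≫ (i.inv ≫ c ≫ i.hom) ≫ i.inv := by simp
        rw [this]
        infer_instance
      have hs : End.of (i.inv ≫ a ≫ i.hom) + End.of (i.inv ≫ b ≫ i.hom) = 1 := by
        change i.inv ≫ a ≫ i.hom + i.inv ≫ b ≫ i.hom = 𝟙 _
        rw [← Preadditive.comp_add, ← Preadditive.add_comp, hab]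
        simp
      exact (IsLocalRing.isUnit_or_isUnit_of_add_one hs).imp (key a) (key b)

end Preliminaries

namespace Extri

variable {C : Type u} [Category.{v} C] [Preadditive C] [HasFiniteBiproducts C]
  {S : ExtriangulatedStructure.{w} C}

namespace STriangle

/-! ### Exactness and base change -/

theorem exists_realizing (S : ExtriangulatedStructure.{w} C) {A Z : C} (δ : Ext S.E Z A) :
    ∃ (B : C) (x : A ⟶ B) (y : B ⟶ Z), S.𝔰 δ = seqClass x y := by
  obtain ⟨s, hs⟩ := Quotient.exists_rep (S.𝔰 δ)
  exact ⟨s.B, s.x, s.y, hs.symm⟩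

theorem pull_eq_zero_iff (X : STriangle S) {Z : C} (c : Z ⟶ X.X₃) :
    pull c X.δ = 0 ↔ ∃ k : Z ⟶ X.X₂, k ≫ X.f₂ = c := by
  constructor
  · intro h
    -- Compare with the split triangle on the same ends: its inclusion `biprod.inr` followed by `b`
    -- is the lift.
    obtain ⟨b, -, hb⟩ := S.realization (S.realization_zero X.X₁ Z) X.realizes (𝟙 _) c
      (by rw [map_zero, h])
    exact ⟨biprod.inr ≫ b, by rw [Category.assoc, ← hb]; simp⟩
  · rintro ⟨k, rfl⟩
    obtain ⟨a, -, ha⟩ := S.et3_op (S.realization_zero X.X₁ Z) X.realizes (biprod.snd ≫ k)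
      (k ≫ X.f₂) (by simp)
    rw [← ha, map_zero]

theorem push_eq_zero_iff (X : STriangle S) {A : C} (a : X.X₁ ⟶ A) :
    push a X.δ = 0 ↔ ∃ k : X.X₂ ⟶ A, X.f₁ ≫ k = a := by
  constructor
  · intro h
    obtain ⟨b, hb, -⟩ := S.realization X.realizes (S.realization_zero A X.X₃) a (𝟙 _)
      (by rw [map_zero, h])
    exact ⟨b ≫ biprod.fst, by rw [← Category.assoc, hb]; simp⟩
  · rintro ⟨k, rfl⟩
    obtain ⟨c, -, hc⟩ := S.et3 X.realizes (S.realization_zero A X.X₃) (X.f₁ ≫ k)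
      (k ≫ biprod.inl) (by simp)
    rw [hc, map_zero]

theorem f₁_comp_f₂ (X : STriangle S) : X.f₁ ≫ X.f₂ = 0 := by
  obtain ⟨c, hc, -⟩ := S.et3 (S.realization_zero X.X₁ X.X₁) X.realizes (𝟙 _)
    (biprod.fst ≫ X.f₁) (by simp)
  have h := biprod.inl ≫= hc
  simpa using h.symm

/-- The base change of an `𝔰`-triangle along `c`, with the morphism `(1, b, c)`. -/
theorem exists_pull (X : STriangle S) {Z : C} (c : Z ⟶ X.X₃) :
    ∃ (B : C) (x : X.X₁ ⟶ B) (y : B ⟶ Z) (h : S.𝔰 (pull c X.δ) = seqClass x y)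
      (φ : STriangle.mk x y (pull c X.δ) h ⟶ X), φ.φ₃ = c := by
  obtain ⟨B, x, y, h⟩ := exists_realizing S (pull c X.δ)
  obtain ⟨b, h₁, h₂⟩ := S.realization h X.realizes (𝟙 _) c (push_id _)
  exact ⟨B, x, y, h, ⟨𝟙 _, b, c, h₁, h₂, push_id _⟩, rfl⟩

/-- The cobase change of an `𝔰`-triangle along `a`, with the morphism `(a, b, 1)`. -/
theorem exists_push (X : STriangle S) {A : C} (a : X.X₁ ⟶ A) :
    ∃ (B : C) (x : A ⟶ B) (y : B ⟶ X.X₃) (h : S.𝔰 (push a X.δ) = seqClass x y)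
      (φ : X ⟶ STriangle.mk x y (push a X.δ) h), φ.φ₃ = 𝟙 _ := by
  obtain ⟨B, x, y, h⟩ := exists_realizing S (push a X.δ)
  obtain ⟨b, h₁, h₂⟩ := S.realization X.realizes h a (𝟙 _) (pull_id _).symm
  exact ⟨B, x, y, h, ⟨a, b, 𝟙 _, h₁, h₂, (pull_id _).symm⟩, rfl⟩

/-! ### The quotient by `R₂` -/

theorem isR₂_iff {X Y : STriangle S} (φ : X ⟶ Y) : IsR₂ φ ↔ pull φ.φ₃ Y.δ = 0 :=
  (Y.pull_eq_zero_iff _).symm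

theorem isSplit_of_isSplitEpi (X : STriangle S) (h : IsSplitEpi X.f₂) : X.IsSplit := by
  have := (X.pull_eq_zero_iff (𝟙 _)).2 ⟨section_ X.f₂, IsSplitEpi.id _⟩
  rwa [pull_id] at this

theorem isSplit_of_isSplitMono (X : STriangle S) (h : IsSplitMono X.f₁) : X.IsSplit := by
  have := (X.push_eq_zero_iff (𝟙 _)).2 ⟨retraction X.f₁, IsSplitMono.id _⟩
  rwa [push_id] at this

variable (S) in
/-- The projection `𝔰-tri(C) ⥤ 𝔰-tri(C)/R₂`. -/
abbrev proj : STriangle S ⥤ STriModR₂ S := CategoryTheory.Quotient.functor (relR₂ S)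

theorem proj_map_eq_iff {X Y : STriangle S} (φ ψ : X ⟶ Y) :
    (proj S).map φ = (proj S).map ψ ↔ pull φ.φ₃ Y.δ = pull ψ.φ₃ Y.δ := by
  rw [CategoryTheory.Quotient.functor_map_eq_iff, relR₂, isR₂_iff, sub_φ₃, sub_eq_add_neg,
    pull_add, pull_neg', ← sub_eq_add_neg, sub_eq_zero]

theorem proj_map_eq_zero_iff {X Y : STriangle S} (φ : X ⟶ Y) :
    (proj S).map φ = 0 ↔ pull φ.φ₃ Y.δ = 0 := by
  have h := proj_map_eq_iff φ 0
  have h₀ : (0 : X ⟶ Y).φ₃ = 0 := rfl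
  rwa [h₀, pull_zero'] at h

/-- Every `c` into `Y.X₃` is the third component of a base change, so testing against triangles is
the same as testing against such `c`. -/
theorem mono_proj_map_iff {Y X : STriangle S} (φ : Y ⟶ X) :
    Mono ((proj S).map φ) ↔
      ∀ {Z : C} (c : Z ⟶ Y.X₃), pull (c ≫ φ.φ₃) X.δ = 0 → pull c Y.δ = 0 := by
  constructor
  · intro _ Z c hc
    obtain ⟨B, x, y, h, κ, hκ⟩ := Y.exists_pull c
    have : (proj S).map κ = 0 := by
      apply zero_of_comp_mono ((proj S).map φ)
      rw [← Functor.map_comp, proj_map_eq_zero_iff, comp_φ₃, hκ, hc]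
    rwa [proj_map_eq_zero_iff, hκ] at this
  · intro h
    refine Preadditive.mono_of_cancel_zero _ fun {T} g hg => ?_
    obtain ⟨T⟩ := T
    obtain ⟨γ, rfl⟩ := (proj S).map_surjective (X := T) g
    rw [← Functor.map_comp] at hg
    exact (proj_map_eq_zero_iff γ).2 (h _ ((proj_map_eq_zero_iff _).1 hg))

theorem proj_map_id_ne_zero {X : STriangle S} (hX : ¬ X.IsSplit) :
    𝟙 X.toQuotient ≠ 0 := by
  intro h
  have h' := (proj_map_eq_zero_iff (𝟙 X)).1 (by rw [CategoryTheory.Functor.map_id]; exact h)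
  exact hX ((pull_id _).symm.trans h')

/-! ### The two implications -/

theorem simple_of_isAuslanderReiten {X : STriangle S} (hX : X.IsAuslanderReiten) :
    Simple X.toQuotient := by
  refine ⟨fun {Y} f _ => ⟨?_, fun hf => ?_⟩⟩
  · rintro hf rfl
    refine proj_map_id_ne_zero hX.nonsplit ?_
    rw [← IsIso.inv_hom_id (0 : Y ⟶ X.toQuotient), comp_zero]
  · obtain ⟨Y⟩ := Y
    obtain ⟨φ, rfl⟩ := (proj S).map_surjective (X := Y) f
    have hmono {Z : C} := (mono_proj_map_iff φ).1 inferInstance (Z := Z)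
    have hs : IsSplitEpi φ.φ₃ := by
      by_contra h
      exact hf ((proj_map_eq_zero_iff φ).2
        ((X.pull_eq_zero_iff _).2 (hX.factors_right _ h)))
    -- The section becomes a third component: monicity makes `X.f₂ ≫ section_ φ.φ₃` kill `Y.δ`,
    -- since composing it with `φ.φ₃` gives `X.f₂`.
    obtain ⟨b, hb⟩ := (Y.pull_eq_zero_iff (X.f₂ ≫ section_ φ.φ₃)).1
      (hmono _ ((X.pull_eq_zero_iff _).2 ⟨𝟙 _, by simp⟩))
    obtain ⟨a, h₁, h₂⟩ := S.et3_op X.realizes Y.realizes b (section_ φ.φ₃) hb.symm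
    let ψ : X ⟶ Y := ⟨a, b, section_ φ.φ₃, h₁, hb.symm, h₂⟩
    have hψ : (proj S).map ψ ≫ (proj S).map φ = 𝟙 _ := by
      rw [← Functor.map_comp, ← CategoryTheory.Functor.map_id, proj_map_eq_iff]
      exact congrArg (fun t => pull t X.δ) (IsSplitEpi.id φ.φ₃)
    have : IsSplitEpi ((proj S).map φ) := ⟨⟨_, hψ⟩⟩
    exact isIso_of_mono_of_isSplitEpi _

theorem factors_left_of_simple (hC : IsKrullSchmidt C) {X : STriangle S} (hX : ¬ X.IsSplit)
    (h₁ : Indecomposable X.X₁) [Simple X.toQuotient] {Y : C} (g : X.X₁ ⟶ Y)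
    (hg : ¬ IsSplitMono g) : ∃ k : X.X₂ ⟶ Y, X.f₁ ≫ k = g := by
  rw [← push_eq_zero_iff]
  by_contra hne
  obtain ⟨B, x, y, h, φ, hφ⟩ := X.exists_push g
  have hφne : (proj S).map φ ≠ 0 := fun h0 => by
    rw [proj_map_eq_zero_iff, hφ, pull_id] at h0
    exact hne h0
  -- The base change along `y` plays the role of the kernel of `φ`: it is mono and composes to zero
  -- with `φ`.
  obtain ⟨B', x', y', h', κ, hκ⟩ := X.exists_pull y
  have hκmono : Mono ((proj S).map κ) := (mono_proj_map_iff κ).2 fun c hc => by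
    rw [hκ, pull_comp] at hc
    exact hc
  have hκφ : (proj S).map κ ≫ (proj S).map φ = 0 := by
    rw [← Functor.map_comp, proj_map_eq_zero_iff, comp_φ₃, hκ, hφ, Category.comp_id]
    exact ((STriangle.mk x y _ h).pull_eq_zero_iff y).2 ⟨𝟙 _, Category.id_comp _⟩
  by_cases hκ0 : (proj S).map κ = 0
  · rw [proj_map_eq_zero_iff, hκ, pull_eq_zero_iff] at hκ0
    obtain ⟨q, hq⟩ := hκ0
    -- A lift `q` of `y` through `X.f₂` yields `a` with `push (g ≫ a) X.δ = X.δ`, so `1 - g ≫ a`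
    -- factors through `X.f₁`.
    obtain ⟨a, -, ha⟩ := S.et3_op h X.realizes q (𝟙 _) (by rw [hq, Category.comp_id])
    have h0 : push (𝟙 _ + -(g ≫ a)) X.δ = 0 := by
      rw [push_add, push_neg', push_id, push_comp, ha, pull_id, add_neg_cancel]
    obtain ⟨k, hk⟩ := (X.push_eq_zero_iff _).1 h0
    rcases isIso_or_isIso_of_add_eq_id hC h₁ (g ≫ a) (X.f₁ ≫ k) (by rw [hk]; abel) with hi | hi
    · exact hg ⟨⟨a ≫ inv (g ≫ a), by rw [← Category.assoc, IsIso.hom_inv_id]⟩⟩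
    · exact hX (X.isSplit_of_isSplitMono
        ⟨⟨k ≫ inv (X.f₁ ≫ k), by rw [← Category.assoc, IsIso.hom_inv_id]⟩⟩)
  · have : IsIso ((proj S).map κ) := isIso_of_mono_of_nonzero (Y := X.toQuotient) hκ0
    exact hφne ((cancel_epi ((proj S).map κ)).1 (by rw [hκφ, comp_zero]))

/-- This makes equality with the identity modulo `R₂` strong enough to give an isomorphism on
`X.X₃`. When only `X.X₂` is known to be local, Jacobson's trick moves the question there, and `X.f₂
≫ p` cannot be invertible because it is killed by `X.f₁ ≠ 0`. -/
theorem isIso_id_sub_comp_f₂ (hC : IsKrullSchmidt C) {X : STriangle S} (hX : ¬ X.IsSplit)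
    (h : Indecomposable X.X₃ ∨ (Indecomposable X.X₂ ∧ X.f₁ ≠ 0)) (p : X.X₃ ⟶ X.X₂) :
    IsIso (𝟙 X.X₃ - p ≫ X.f₂) := by
  rcases h with h | ⟨h, hf⟩
  · rcases isIso_or_isIso_of_add_eq_id hC h (𝟙 _ - p ≫ X.f₂) (p ≫ X.f₂) (by abel) with hi | hi
    · exact hi
    · exact absurd (X.isSplit_of_isSplitEpi
        ⟨⟨inv (p ≫ X.f₂) ≫ p, by rw [Category.assoc, IsIso.inv_hom_id]⟩⟩) hX
  · apply isIso_id_sub_comp_of_isIso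
    rcases isIso_or_isIso_of_add_eq_id hC h (𝟙 _ - X.f₂ ≫ p) (X.f₂ ≫ p) (by abel) with hi | hi
    · exact hi
    · refine absurd ?_ hf
      rw [← cancel_mono (X.f₂ ≫ p), ← Category.assoc, f₁_comp_f₂, zero_comp, zero_comp]

theorem factors_right_of_simple (hC : IsKrullSchmidt C) {X : STriangle S} (hX : ¬ X.IsSplit)
    (h : Indecomposable X.X₃ ∨ (Indecomposable X.X₂ ∧ X.f₁ ≠ 0)) [Simple X.toQuotient]
    {Z : C} (c : Z ⟶ X.X₃) (hc : ¬ IsSplitEpi c) : ∃ k : Z ⟶ X.X₂, k ≫ X.f₂ = c := by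
  rw [← pull_eq_zero_iff]
  by_contra hne
  obtain ⟨B, x, y, hB, φ, hφ⟩ := X.exists_pull c
  have hmono : Mono ((proj S).map φ) := (mono_proj_map_iff φ).2 fun d hd => by
    rw [hφ, pull_comp] at hd
    exact hd
  have hφne : (proj S).map φ ≠ 0 := fun h0 => by
    rw [proj_map_eq_zero_iff, hφ] at h0
    exact hne h0
  have : IsIso ((proj S).map φ) := isIso_of_mono_of_nonzero (Y := X.toQuotient) hφne
  -- A lift of the inverse satisfies `ψ.φ₃ ≫ c = 1 - p ≫ X.f₂` for some `p`.
  obtain ⟨ψ, hψ⟩ := (proj S).map_surjective (inv ((proj S).map φ))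
  have hid : (proj S).map (𝟙 X) = (proj S).map (ψ ≫ φ) := by
    rw [Functor.map_comp, hψ, IsIso.inv_hom_id, CategoryTheory.Functor.map_id]
  rw [CategoryTheory.Quotient.functor_map_eq_iff] at hid
  obtain ⟨p, hp⟩ := hid
  rw [sub_φ₃, comp_φ₃, hφ] at hp
  have hi := isIso_id_sub_comp_f₂ hC hX h p
  have he : 𝟙 X.X₃ - p ≫ X.f₂ = ψ.φ₃ ≫ c := by
    rw [hp]
    exact sub_sub_cancel _ _
  rw [he] at hi
  exact hc ⟨⟨inv (ψ.φ₃ ≫ c) ≫ ψ.φ₃, by rw [Category.assoc, IsIso.inv_hom_id]⟩⟩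

end STriangle

end Extri

theorem mainTheorem9 {C : Type u} [Category.{v} C] [Preadditive C] [HasFiniteBiproducts C]
    (S : Extri.ExtriangulatedStructure.{w} C) (hC : Extri.IsKrullSchmidt C)
    (X : Extri.STriangle S) (hX : ¬ X.IsSplit) (h₁ : Indecomposable X.X₁)
    (h : Indecomposable X.X₃ ∨ (Indecomposable X.X₂ ∧ X.f₁ ≠ 0)) :
    Simple X.toQuotient ↔ X.IsAuslanderReiten :=
  ⟨fun _ => ⟨hX, fun g hg => Extri.STriangle.factors_left_of_simple hC hX h₁ g hg,
    fun c hc => Extri.STriangle.factors_right_of_simple hC hX h c hc⟩,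
    Extri.STriangle.simple_of_isAuslanderReiten⟩
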